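/- Write $\mathbb{N}=\{1,2,3,\dots\}$. Let $\Gamma$ be a connected simple graph with path metric $d$, and let $n,\sigma,\psi,\rho,R\in\mathbb{N}$ and a vertex $v$ of $\Gamma$ be given. In the game with $n$ cops, treasure $v$, cop speed $\sigma$, robber speed $\psi$, cop reach $\rho$ and robber radius $R$, two players with perfect information play as follows. The cop player chooses $n$ vertices (not necessarily distinct) as starting positions of the cops, then the robber player chooses a starting vertex of the robber. After that the game consists of infinitely many stages; in each stage the cop player first moves each cop along an edge path of length at most $\sigma$, and then the robber player moves the robber along an edge path of length at most $\psi$ (staying put is allowed). The cop player wins if the robber is captured, that is, if at some moment (at the start, or at some vertex of the robber's path in some stage, endpoints included) the robber is at distance at most $\rho$ from some cop, or if from some stage on the robber never enters the closed ball of radius $R$ around $v$. The weak cop number $\operatorname{wCop}(\Gamma)\in\mathbb{N}\cup\{\infty\}$ is the infimum of all $n\in\mathbb{N}$ such that $$\forall v\in\Gamma\ \exists \sigma\in\mathbb{N}\ \exists\rho\in\mathbb{N}\ \forall\psi\in\mathbb{N}\ \forall R\in\mathbb{N}:\ \text{the cop player has a winning strategy with } n \text{ cops},$$ and the strong cop number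 $\operatorname{sCop}(\Gamma)\in\mathbb{N}\cup\{\infty\}$ is the infimum of all $n\in\mathbb{N}$ such that $$\forall v\in\Gamma\ \exists \sigma\in\mathbb{N}\ \forall\psi\in\mathbb{N}\ \exists\rho\in\mathbb{N}\ \forall R\in\mathbb{N}:\ \text{the cop player has a winning strategy with } n \text{ cops},$$ where $\inf\emptyset=\infty$. The cop numbers of a finitely generated group are those of its Cayley graphs with respect to finite generating sets. **Theorem.** For every integer $m\ge 1$, the solvable Baumslag–Solitar group $\operatorname{BS}(1,m)=\langle a,t : tat^{-1}=a^m\rangle$ has infinite strong and infinite weak cop number: for every finite generating set $S$ of $\operatorname{BS}(1,m)$, $$\operatorname{sCop}(\operatorname{Cay}(\operatorname{BS}(1,m),S))=\infty\quad\text{and}\quad \operatorname{wCop}(\operatorname{Cay}(\operatorname{BS}(1,m),S))=\infty .$$ -/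

import Mathlib

namespace CopGame

variable {V : Type*}

/-- A full sequence of robber moves with speed `ψ`: an initial vertex `pos 0` and, for every stage
`k`, an edge path `walk k` of length at most `ψ` from `pos k` to `pos (k + 1)`. -/
structure RobberPlay (G : SimpleGraph V) (ψ : ℕ) where
  pos : ℕ → V
  walk : ∀ k : ℕ, G.Walk (pos k) (pos (k + 1))
  length_le : ∀ k : ℕ, (walk k).length ≤ ψ

/-- What the cop player has seen of the robber when moving in stage `k`: the initial vertex of the
robber, followed by the paths (as lists of vertices) of the robber in the stages `0, …, k - 1`. -/
def RobberPlay.history {G : SimpleGraph V} {ψ : ℕ} (p : RobberPlay G ψ) (k : ℕ) : List (List V) :=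
  [p.pos 0] :: (List.range k).map fun j => (p.walk j).support

/-- A strategy for the player of `n` cops: the starting vertices of the cops, and the vertices to
which the cops move next, as a function of what has been seen of the robber so far. (The earlier
positions of the cops are determined by these data, so they need not be an argument.) -/
structure CopStrategy (V : Type*) (n : ℕ) where
  init : Fin n → V
  move : List (List V) → Fin n → V

namespace CopStrategy

variable {n : ℕ} {G : SimpleGraph V} {ψ : ℕ}

/-- The positions of the cops against the robber play `p`: `copPos p 0` are the starting positions
(chosen before the robber chooses a vertex), `copPos p (k + 1)` the positions after the move of the
cops in stage `k`. -/
def copPos (S : CopStrategy V n) (p : RobberPlay G ψ) : ℕ → Fin n → V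
  | 0 => S.init
  | k + 1 => S.move (p.history k)

/-- In each turn, each cop moves along a path of length at most `σ`. -/
def Legal (S : CopStrategy V n) (G : SimpleGraph V) (σ ψ : ℕ) : Prop :=
  ∀ (p : RobberPlay G ψ) (k : ℕ) (i : Fin n),
    ∃ w : G.Walk (S.copPos p k i) (S.copPos p (k + 1) i), w.length ≤ σ

/-- The robber is captured: at the start, or at some moment of the robber's path in some stage
(this includes the vertex where the robber waits while the cops move, and the end of the path),
the robber is at distance at most `ρ` from some cop. -/
def Captures (S : CopStrategy V n) (ρ : ℕ) (p : RobberPlay G ψ) : Prop :=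
  (∃ i : Fin n, G.edist (S.copPos p 0 i) (p.pos 0) ≤ (ρ : ℕ∞)) ∨
    ∃ (k : ℕ) (i : Fin n), ∃ x ∈ (p.walk k).support,
      G.edist (S.copPos p (k + 1) i) x ≤ (ρ : ℕ∞)

end CopStrategy

/-- From some stage on, the robber never enters the closed ball of radius `R` around `v`. -/
def RobberPlay.EventuallyAvoids {G : SimpleGraph V} {ψ : ℕ} (p : RobberPlay G ψ) (v : V) (R : ℕ) :
    Prop :=
  ∃ N : ℕ, ∀ k : ℕ, N ≤ k → ∀ x ∈ (p.walk k).support, ¬ G.edist v x ≤ (R : ℕ∞)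

/-- The player of `n` cops has a winning strategy in the game on `G` with treasure `v`, cop speed
`σ`, robber speed `ψ`, cop reach `ρ` and robber radius `R`. -/
def CopsWin (G : SimpleGraph V) (n : ℕ) (v : V) (σ ψ ρ R : ℕ) : Prop :=
  ∃ S : CopStrategy V n, S.Legal G σ ψ ∧
    ∀ p : RobberPlay G ψ, S.Captures ρ p ∨ p.EventuallyAvoids v R

/-- `n` cops win the weak game: speed and reach of the cops are chosen first. -/
def WeakCopWin (G : SimpleGraph V) (n : ℕ) : Prop :=
  ∀ v : V, ∃ σ : ℕ, 1 ≤ σ ∧ ∃ ρ : ℕ, 1 ≤ ρ ∧ ∀ ψ : ℕ, 1 ≤ ψ → ∀ R : ℕ, 1 ≤ R →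
    CopsWin G n v σ ψ ρ R

/-- `n` cops win the strong game: the reach of the cops is chosen after the robber's speed. -/
def StrongCopWin (G : SimpleGraph V) (n : ℕ) : Prop :=
  ∀ v : V, ∃ σ : ℕ, 1 ≤ σ ∧ ∀ ψ : ℕ, 1 ≤ ψ → ∃ ρ : ℕ, 1 ≤ ρ ∧ ∀ R : ℕ, 1 ≤ R →
    CopsWin G n v σ ψ ρ R

/-- The weak cop number of a graph; it is `⊤` when no finite number of cops suffices. -/
noncomputable def wCop (G : SimpleGraph V) : ℕ∞ :=
  sInf ((fun n : ℕ => (n : ℕ∞)) '' {n : ℕ | 1 ≤ n ∧ WeakCopWin G n})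

/-- The strong cop number of a graph; it is `⊤` when no finite number of cops suffices. -/
noncomputable def sCop (G : SimpleGraph V) : ℕ∞ :=
  sInf ((fun n : ℕ => (n : ℕ∞)) '' {n : ℕ | 1 ≤ n ∧ StrongCopWin G n})

end CopGame

/-- The defining relator `t a t⁻¹ (a ^ m)⁻¹` in the free group on `a = of 0` and `t = of 1`. -/
def solvableBSRel (m : ℕ) : FreeGroup (Fin 2) :=
  FreeGroup.of 1 * FreeGroup.of 0 * (FreeGroup.of 1)⁻¹ * (FreeGroup.of 0 ^ m)⁻¹

/-- The solvable Baumslag–Solitar group `BS(1, m) = ⟨a, t : t a t⁻¹ = a ^ m⟩`. -/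
abbrev SolvableBS (m : ℕ) : Type :=
  PresentedGroup ({solvableBSRel m} : Set (FreeGroup (Fin 2)))

/-! A weak win is a strong win, so it suffices that `n` cops never win the strong game. There the
robber's speed is chosen after `σ` but before `ρ`: he may be any fixed factor faster than the cops,
while the scale `r` on which he must avoid them is arbitrarily large. So he needs, at every large
scale `r`, a finite configuration of safe places joined by routes of length `O(r)`, with constants
independent of `r`, such that some route stays far from all cops (`not_strongCopWin_of_safe`). If
each cop spoils at most two of more than `2 * n` options, a free one exists.

For `m = 1` the group is `ℤ²`, and a grid with spacing proportional to `r` works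
(`not_strongCopWin_of_grid`).

For `m ≥ 2` the configuration is a complete bipartite graph (`not_strongCopWin_of_stars`): tops `a ^
j * t ^ L` and bottoms `a ^ (i * m ^ L)`, joined by the vertical segments `a ^ (i * m ^ L + j) * t ^
h`, `0 ≤ h ≤ L`, with `L` proportional to `r`. As `t ^ L * a ^ i = a ^ (i * m ^ L) * t ^ L`, each
segment ends within bounded distance of its two vertices. Segments at one bottom branch upwards as
in a tree (`Small.height_lt`, a divisibility argument); segments at one top diverge downwards as in
the hyperbolic plane (`Small.le_height`, a size argument). The lower bounds on distances come from
the affine action on `ℚ`: word length controls the denominator and the absolute value of the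
translation part (`exists_small_of_dist_le`). -/

namespace CopGame

/-! ### The replanning robber and the reduction to safe positions. -/

variable {V : Type*} {G : SimpleGraph V}

/-- A position of a robber who is on the way from `x` to `y` along `path`, together with
the history of the game so far. -/
structure RobberState (G : SimpleGraph V) where
  hist : List (List V)
  x : V
  y : V
  path : G.Walk x y

namespace RobberState

/-- Every `T` stages the robber replaces his plan. -/
def replan (plan : List (List V) → ∀ x : V, Σ y : V, G.Walk x y) (T k : ℕ) (s : RobberState G) :
    Σ y : V, G.Walk s.x y :=
  if T ∣ k then plan s.hist s.x else ⟨s.y, s.path⟩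

/-- The robber follows his plan for `ψ` steps. -/
def advance (s : RobberState G) (q : Σ y : V, G.Walk s.x y) (ψ : ℕ) : RobberState G :=
  ⟨s.hist ++ [(q.2.take ψ).support], q.2.getVert ψ, q.1, q.2.drop ψ⟩

/-- The successive states of a robber who replans every `T` stages. -/
def run (plan : List (List V) → ∀ x : V, Σ y : V, G.Walk x y) (T ψ : ℕ) (x₀ : V) :
    ℕ → RobberState G
  | 0 => ⟨[[x₀]], x₀, x₀, .nil⟩
  | k + 1 => (run plan T ψ x₀ k).advance ((run plan T ψ x₀ k).replan plan T k) ψ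

end RobberState

open RobberState

/-- The play of a robber who replans every `T` stages. -/
def planPlay (plan : List (List V) → ∀ x : V, Σ y : V, G.Walk x y) (T ψ : ℕ) (x₀ : V) :
    RobberPlay G ψ where
  pos k := (run plan T ψ x₀ k).x
  walk k := ((run plan T ψ x₀ k).replan plan T k).2.take ψ
  length_le _ := (SimpleGraph.Walk.take_length _ _).trans_le (min_le_left _ _)

section planPlay

variable (plan : List (List V) → ∀ x : V, Σ y : V, G.Walk x y) (T ψ : ℕ) (x₀ : V)

lemma run_hist (k : ℕ) :
    (run plan T ψ x₀ k).hist = (planPlay plan T ψ x₀).history k := by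
  induction k with
  | zero => simp [run, planPlay, RobberPlay.history]
  | succ k ih =>
    rw [run, advance, ih]
    simp only [RobberPlay.history, List.range_succ, List.map_append, List.cons_append]
    rfl

lemma replan_of_dvd {k : ℕ} (h : T ∣ k) (s : RobberState G) :
    s.replan plan T k = plan s.hist s.x := if_pos h

lemma replan_of_not_dvd {k : ℕ} (h : ¬ T ∣ k) (s : RobberState G) :
    s.replan plan T k = ⟨s.y, s.path⟩ := if_neg h

/-- Within one period, the robber follows the plan made at its beginning. -/
lemma replan_run (e : ℕ) (Y : V) (W : G.Walk (run plan T ψ x₀ (e * T)).x Y)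
    (hW : plan (run plan T ψ x₀ (e * T)).hist (run plan T ψ x₀ (e * T)).x = ⟨Y, W⟩)
    (hlen : W.length ≤ T * ψ) (j : ℕ) (hj : j < T) :
    ((run plan T ψ x₀ (e * T + j)).replan plan T (e * T + j)).1 = Y ∧
    ((run plan T ψ x₀ (e * T + j)).replan plan T (e * T + j)).2.length ≤ (T - j) * ψ ∧
    ((run plan T ψ x₀ (e * T + j)).replan plan T (e * T + j)).2.support ⊆ W.support := by
  induction j with
  | zero =>
    simp only [Nat.add_zero]
    rw [replan_of_dvd _ _ (Dvd.intro_left e rfl), hW]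
    exact ⟨rfl, by simpa using hlen, fun _ h => h⟩
  | succ j ih =>
    obtain ⟨h1, h2, h3⟩ := ih (by omega)
    have hnd : ¬ T ∣ e * T + (j + 1) := by
      rw [Nat.dvd_add_right (Dvd.intro_left e rfl)]
      exact fun h => absurd (Nat.le_of_dvd (by omega) h) (by omega)
    rw [replan_of_not_dvd _ _ hnd, ← Nat.add_assoc, run, advance]
    refine ⟨h1, ?_, ?_⟩
    · simp only [SimpleGraph.Walk.drop_length]
      have : T - j = (T - (j + 1)) + 1 := by omega
      rw [this, Nat.add_mul] at h2
      omega
    · refine List.Subset.trans ?_ h3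
      simp only [SimpleGraph.Walk.drop_support_eq_support_drop_min]
      exact List.drop_subset _ _

lemma run_period (hT : 1 ≤ T) (e : ℕ) (Y : V) (W : G.Walk (run plan T ψ x₀ (e * T)).x Y)
    (hW : plan (run plan T ψ x₀ (e * T)).hist (run plan T ψ x₀ (e * T)).x = ⟨Y, W⟩)
    (hlen : W.length ≤ T * ψ) : (run plan T ψ x₀ ((e + 1) * T)).x = Y := by
  obtain ⟨h1, h2, -⟩ := replan_run plan T ψ x₀ e Y W hW hlen (T - 1) (by omega)
  have : (e + 1) * T = (e * T + (T - 1)) + 1 := by rw [Nat.add_mul]; omega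
  rw [this, run, advance]
  have h : T - (T - 1) = 1 := by omega
  rw [h, one_mul] at h2
  rw [← h1]
  exact SimpleGraph.Walk.getVert_of_length_le _ h2

end planPlay

lemma CopStrategy.Legal.dist_copPos_le {n σ ψ : ℕ} {S : CopStrategy V n} (hG : G.Connected)
    (hS : S.Legal G σ ψ) (p : RobberPlay G ψ) (k j : ℕ) (i : Fin n) :
    G.dist (S.copPos p k i) (S.copPos p (k + j) i) ≤ j * σ := by
  induction j with
  | zero => simp
  | succ j ih =>
    obtain ⟨w, hw⟩ := hS p (k + j) i
    have h1 := hG.dist_triangle (u := S.copPos p k i) (v := S.copPos p (k + j) i)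
      (w := S.copPos p (k + j + 1) i)
    have h2 := SimpleGraph.dist_le w
    rw [← Nat.add_assoc, Nat.add_mul]
    omega

/-- The cops lose if, at every large scale `r`, the robber can stay in a set of safe positions:
whenever the cops have moved by at most `r`, there is a way of length `O(r)` to
a new safe position that keeps away from the cops by more than `2r`. -/
theorem not_strongCopWin_of_safe (hG : G.Connected) (n : ℕ) (v : V) (K r₀ : ℕ)
    (h : ∀ r, r₀ ≤ r → ∃ (R : ℕ) (Safe : V → (Fin n → V) → Prop),
      (∀ x c, Safe x c → G.dist v x ≤ R) ∧ (∀ c, ∃ x, Safe x c) ∧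
      ∀ x c c', Safe x c → (∀ i, G.dist (c i) (c' i) ≤ r) →
        ∃ y, Safe y c' ∧ ∃ w : G.Walk x y, w.length ≤ K * r ∧
          ∀ z ∈ w.support, ∀ i, 2 * r < G.dist (c' i) z) :
    ¬ StrongCopWin G n := by
  classical
  intro hwin
  obtain ⟨σ, hσ, hwin⟩ := hwin v
  -- This speed ignores `ρ`, yet for every `T` a route of length `K * (T * σ)` fits into `T` stages.
  -- The `+ 1` keeps it positive if `K = 0`.
  obtain ⟨ρ, hρ, hwin⟩ := hwin ((K + 1) * σ) (Nat.mul_pos (by omega) hσ)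
  set ψ := (K + 1) * σ with hψ
  -- With this period, `r` is at least `ρ`, `r₀` and `σ`, and bounds how far a cop moves in `T`
  -- stages.
  set T := ρ + r₀ with hT
  set r := T * σ with hr
  have hTr : T ≤ r := Nat.le_mul_of_pos_right _ hσ
  have hσr : σ ≤ r := Nat.le_mul_of_pos_left _ (by omega)
  obtain ⟨R, Safe, hR, hex, hmove⟩ := h r (by omega)
  obtain ⟨S, hlegal, hS⟩ := hwin (R + 1) (by omega)
  have edist_le_iff : ∀ (x y : V) (N : ℕ), G.edist x y ≤ N ↔ G.dist x y ≤ N := fun x y N => by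
    rw [← (hG x y).coe_dist_eq_edist]; exact Nat.cast_le
  obtain ⟨x₀, hx₀⟩ := hex S.init
  let Good (c : Fin n → V) (x : V) (q : Σ y : V, G.Walk x y) : Prop :=
    Safe q.1 c ∧ q.2.length ≤ K * r ∧ ∀ z ∈ q.2.support, ∀ i, 2 * r < G.dist (c i) z
  -- `S.move hist` is where the cops stand after the move just made, so the robber answers that
  -- move. The default of staying put never occurs along `p`, by `hgood` and `hinv`.
  let plan (hist : List (List V)) (x : V) : Σ y : V, G.Walk x y :=
    if hq : ∃ q, Good (S.move hist) x q then hq.choose else ⟨x, .nil⟩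
  let p := planPlay plan T ψ x₀
  have hKr : K * r ≤ T * ψ := by
    rw [hr, hψ]
    calc K * (T * σ) = T * (K * σ) := by ring
      _ ≤ T * ((K + 1) * σ) := by gcongr; omega
  have hgood : ∀ e, (∃ c, Safe (p.pos (e * T)) c ∧
      ∀ i, G.dist (c i) (S.copPos p (e * T + 1) i) ≤ r) →
      Good (S.copPos p (e * T + 1)) (p.pos (e * T))
        (plan (run plan T ψ x₀ (e * T)).hist (p.pos (e * T))) := by
    rintro e ⟨c, hc, hd⟩
    obtain ⟨y, hy, w, hw, hz⟩ := hmove _ _ _ hc hd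
    have hm : S.move (run plan T ψ x₀ (e * T)).hist = S.copPos p (e * T + 1) := by
      rw [run_hist]; rfl
    have hq : ∃ q, Good (S.move (run plan T ψ x₀ (e * T)).hist) (p.pos (e * T)) q :=
      ⟨⟨y, w⟩, by rw [hm]; exact ⟨hy, hw, hz⟩⟩
    have hplan : plan (run plan T ψ x₀ (e * T)).hist (p.pos (e * T)) = hq.choose := dif_pos hq
    rw [hplan, ← hm]
    exact hq.choose_spec
  -- The position reached after a period is safe against the cops as they stood when the route was
  -- planned; since then they have made `T` moves, hence moved by at most `r`.
  have hinv : ∀ e, ∃ c, Safe (p.pos (e * T)) c ∧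
      ∀ i, G.dist (c i) (S.copPos p (e * T + 1) i) ≤ r := by
    intro e
    induction e with
    | zero =>
      refine ⟨S.init, by simpa [p, planPlay, run] using hx₀, fun i => ?_⟩
      have := hlegal.dist_copPos_le hG p 0 1 i
      simp only [Nat.zero_mul, Nat.zero_add, one_mul] at this ⊢
      exact this.trans hσr
    | succ e ih =>
      obtain ⟨h1, h2, -⟩ := hgood e ih
      refine ⟨S.copPos p (e * T + 1), ?_, fun i => ?_⟩
      · have := run_period plan T ψ x₀ (by omega) e _ _ rfl (h2.trans hKr)
        change Safe (run plan T ψ x₀ ((e + 1) * T)).x _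
        rw [this]
        exact h1
      · have := hlegal.dist_copPos_le hG p (e * T + 1) T i
        have h3 : (e + 1) * T + 1 = e * T + 1 + T := by ring
        rwa [h3]
  -- The clearance `2 * r` at planning time, minus at most `r` for the cops' moves within the
  -- period.
  have hfar : ∀ k, ∀ z ∈ (p.walk k).support, ∀ i, r < G.dist (S.copPos p (k + 1) i) z := by
    intro k z hz i
    obtain ⟨e, j, hj, rfl⟩ : ∃ e j, j < T ∧ k = e * T + j :=
      ⟨k / T, k % T, Nat.mod_lt _ (by omega), (Nat.div_add_mod' k T).symm⟩
    obtain ⟨-, h2, h3⟩ := hgood e (hinv e)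
    obtain ⟨-, -, hsub⟩ := replan_run plan T ψ x₀ e _ _ rfl (h2.trans hKr) j hj
    have hz' := h3 z (hsub (by
      have : z ∈ (((run plan T ψ x₀ (e * T + j)).replan plan T (e * T + j)).2.take ψ).support := hz
      rw [SimpleGraph.Walk.support_take] at this
      exact List.mem_of_mem_take this)) i
    have hd := hlegal.dist_copPos_le hG p (e * T + 1) j i
    have hjr : j * σ ≤ r := Nat.mul_le_mul_right _ hj.le
    rw [show e * T + 1 + j = e * T + j + 1 by ring] at hd
    have := hG.dist_triangle (u := S.copPos p (e * T + 1) i)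
      (v := S.copPos p (e * T + j + 1) i) (w := z)
    omega
  rcases hS p with hcap | ⟨N, hN⟩
  · rcases hcap with ⟨i, hi⟩ | ⟨k, i, z, hz, hi⟩
    · rw [edist_le_iff] at hi
      obtain ⟨c, hc, hd⟩ := hinv 0
      obtain ⟨-, -, h3⟩ := hgood 0 (hinv 0)
      have h4 := h3 _ (SimpleGraph.Walk.start_mem_support _) i
      have h5 := hlegal.dist_copPos_le hG p 0 1 i
      have h6 := hG.dist_triangle (u := S.copPos p 1 i) (v := S.copPos p 0 i) (w := p.pos 0)
      rw [SimpleGraph.dist_comm] at h5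
      simp only [Nat.zero_mul, Nat.zero_add, one_mul] at h4 h5
      omega
    · rw [edist_le_iff] at hi
      have := hfar k z hz i
      omega
  · obtain ⟨c, hc, -⟩ := hinv N
    refine hN (N * T) (Nat.le_mul_of_pos_right _ (by omega)) _
      (SimpleGraph.Walk.start_mem_support _) ?_
    rw [edist_le_iff]
    exact (hR _ _ hc).trans (by omega)

lemma WeakCopWin.strongCopWin {n : ℕ} (h : WeakCopWin G n) : StrongCopWin G n := by
  intro v
  obtain ⟨σ, hσ, ρ, hρ, h⟩ := h v
  exact ⟨σ, hσ, fun ψ hψ => ⟨ρ, hρ, fun R hR => h ψ hψ R hR⟩⟩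

theorem sCop_and_wCop_eq_top (h : ∀ n, ¬ StrongCopWin G n) : sCop G = ⊤ ∧ wCop G = ⊤ := by
  constructor
  · simp [sCop, h]
  · have h' : ∀ n, ¬ WeakCopWin G n := fun n hn => h n hn.strongCopWin
    simp [wCop, h']

end CopGame

/-! ### Configurations on which the robber escapes: grids and stars. -/

namespace CopGame

variable {V : Type*} {G : SimpleGraph V}

/-- There is a walk of length at most `l` from `x` to `y` in the `C`-neighbourhood of `P`. -/
def WalkNear (G : SimpleGraph V) (C : ℕ) (P : Set V) (l : ℕ) (x y : V) : Prop :=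
  ∃ w : G.Walk x y, w.length ≤ l ∧ ∀ z ∈ w.support, ∃ p ∈ P, G.dist p z ≤ C

namespace WalkNear

variable {C l l' : ℕ} {P : Set V} {x y z : V}

lemma mono (h : WalkNear G C P l x y) (hl : l ≤ l') : WalkNear G C P l' x y :=
  let ⟨w, hw, hP⟩ := h
  ⟨w, hw.trans hl, hP⟩

lemma symm (h : WalkNear G C P l x y) : WalkNear G C P l y x :=
  let ⟨w, hw, hP⟩ := h
  ⟨w.reverse, by simpa using hw, fun z hz => hP z (by simpa using hz)⟩

lemma trans (h : WalkNear G C P l x y) (h' : WalkNear G C P l' y z) :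
    WalkNear G C P (l + l') x z := by
  obtain ⟨w, hw, hP⟩ := h
  obtain ⟨w', hw', hP'⟩ := h'
  refine ⟨w.append w', by rw [SimpleGraph.Walk.length_append]; omega, fun u hu => ?_⟩
  rcases (SimpleGraph.Walk.mem_support_append_iff _ _).1 hu with hu | hu
  exacts [hP u hu, hP' u hu]

lemma of_dist_le (hG : G.Connected) (hx : x ∈ P) (h : G.dist x y ≤ C) :
    WalkNear G C P C x y := by
  obtain ⟨w, hw⟩ := hG.exists_walk_length_eq_dist x y
  refine ⟨w, hw.trans_le h, fun z hz => ⟨x, hx, ?_⟩⟩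
  classical
  exact (SimpleGraph.dist_le (w.takeUntil z hz)).trans
    ((w.length_takeUntil_le_length hz).trans (hw.trans_le h))

lemma chain (hG : G.Connected) (f : ℕ → V) (M : ℕ) (hP : ∀ k ≤ M, f k ∈ P)
    (hd : ∀ k < M, G.dist (f k) (f (k + 1)) ≤ C) :
    WalkNear G C P (M * C) (f 0) (f M) := by
  induction M with
  | zero =>
    exact ⟨.nil, by simp, fun z hz => ⟨f 0, hP 0 le_rfl, by simp_all⟩⟩
  | succ M ih =>
    rw [Nat.add_mul, one_mul]
    exact (ih (fun k hk => hP k (by omega)) (fun k hk => hd k (by omega))).trans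
      (of_dist_le hG (hP M (by omega)) (hd M (by omega)))

/-- A walk near `P` keeps away from every vertex that is far from `P`. -/
lemma exists_walk_far (hG : G.Connected) (h : WalkNear G C P l x y) {r : ℕ} (hr : C ≤ r)
    {ι : Type*} (c : ι → V) (hc : ∀ i, ∀ p ∈ P, 3 * r < G.dist (c i) p) :
    ∃ w : G.Walk x y, w.length ≤ l ∧ ∀ z ∈ w.support, ∀ i, 2 * r < G.dist (c i) z := by
  obtain ⟨w, hw, hP⟩ := h
  refine ⟨w, hw, fun z hz i => ?_⟩
  obtain ⟨p, hp, hpz⟩ := hP z hz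
  have h1 := hc i p hp
  have h2 := hG.dist_triangle (u := c i) (v := z) (w := p)
  rw [SimpleGraph.dist_comm (u := z)] at h2
  omega

end WalkNear

/-- If each of `n` cops blocks at most two of more than `2n` options, one option is free. -/
lemma exists_unblocked {n N : ℕ} (hN : 2 * n < N) (A B : Fin n → Fin N → Prop)
    (hA : ∀ i j j', A i j → A i j' → j = j') (hB : ∀ i j j', B i j → B i j' → j = j') :
    ∃ j, ∀ i, ¬ A i j ∧ ¬ B i j := by
  by_contra! hcon
  have : ∀ j, ∃ s : Fin n ⊕ Fin n, Sum.elim (fun i => A i j) (fun i => B i j) s := by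
    intro j
    obtain ⟨i, hi⟩ := hcon j
    by_cases h : A i j
    · exact ⟨.inl i, h⟩
    · exact ⟨.inr i, hi h⟩
  choose f hf using this
  have hinj : Function.Injective f := by
    intro j j' h
    have h1 := hf j
    have h2 := hf j'
    rw [← h] at h2
    rcases hs : f j with i | i <;> rw [hs] at h1 h2
    exacts [hA i _ _ h1 h2, hB i _ _ h1 h2]
  have := Fintype.card_le_of_injective f hinj
  simp only [Fintype.card_sum, Fintype.card_fin] at this
  omega

/-- Triangle inequality through `c`; this supplies the hypotheses of `exists_unblocked`. -/
lemma eq_of_both_near (hG : G.Connected) {s : ℕ} {N : ℕ} {P : Fin N → Set V}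
    (hP : ∀ j j', j ≠ j' → ∀ z ∈ P j, ∀ z' ∈ P j', 2 * s < G.dist z z') (c : V) (j j' : Fin N)
    (h : ∃ z ∈ P j, G.dist c z ≤ s) (h' : ∃ z ∈ P j', G.dist c z ≤ s) : j = j' := by
  by_contra hne
  obtain ⟨z, hz, hd⟩ := h
  obtain ⟨z', hz', hd'⟩ := h'
  have h1 := hP j j' hne z hz z' hz'
  have h2 := hG.dist_triangle (u := z) (v := c) (w := z')
  rw [SimpleGraph.dist_comm (u := z) (v := c)] at h2
  omega

/-- The cops lose if at every large scale there is a grid of rows and columns that are far from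
each other. -/
theorem not_strongCopWin_of_grid (hG : G.Connected) (n N : ℕ) (hN : 2 * n < N) (K C r₀ : ℕ)
    (h : ∀ r, r₀ ≤ r → ∃ (vert : Fin N → Fin N → V) (Col Row : Fin N → Set V),
      (∀ i i', i ≠ i' → ∀ z ∈ Col i, ∀ z' ∈ Col i', 2 * (4 * r) < G.dist z z') ∧
      (∀ j j', j ≠ j' → ∀ z ∈ Row j, ∀ z' ∈ Row j', 2 * (3 * r) < G.dist z z') ∧
      (∀ i j j', WalkNear G C (Col i) (K * r) (vert i j) (vert i j')) ∧
      (∀ i i' j, WalkNear G C (Row j) (K * r) (vert i j) (vert i' j))) :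
    ¬ StrongCopWin G n := by
  have : NeZero N := ⟨by omega⟩
  obtain ⟨v⟩ := hG.nonempty
  refine not_strongCopWin_of_safe hG n v (2 * K) (max r₀ C) fun r hr => ?_
  obtain ⟨vert, Col, Row, hCol, hRow, hwCol, hwRow⟩ := h r (le_of_max_le_left hr)
  have hCr : C ≤ r := le_of_max_le_right hr
  have hfree : ∀ c : Fin n → V, ∃ k, ∀ i, ∀ z ∈ Col k, 4 * r < G.dist (c i) z := by
    intro c
    have hA := fun i => eq_of_both_near hG hCol (c i)
    obtain ⟨k, hk⟩ := exists_unblocked hN (fun i k => ∃ z ∈ Col k, G.dist (c i) z ≤ 4 * r)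
      (fun i k => ∃ z ∈ Col k, G.dist (c i) z ≤ 4 * r) hA hA
    refine ⟨k, fun i z hz => ?_⟩
    by_contra! hcon
    exact (hk i).1 ⟨z, hz, hcon⟩
  obtain ⟨R, hR⟩ := (Set.finite_range fun q : Fin N × Fin N => G.dist v (vert q.1 q.2)).bddAbove
  -- The clearance `4 * r` of the current column is still `3 * r` after the cops' move, so the
  -- robber runs along it to a free row and along that row to a column free for the new cop
  -- positions. These two legs account for `2 * K`.
  refine ⟨R, fun x c => ∃ k j, x = vert k j ∧ ∀ i, ∀ z ∈ Col k, 4 * r < G.dist (c i) z, ?_, ?_, ?_⟩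
  · rintro x c ⟨k, j, rfl, -⟩
    exact hR ⟨(k, j), rfl⟩
  · intro c
    obtain ⟨k, hk⟩ := hfree c
    exact ⟨vert k 0, k, 0, rfl, hk⟩
  · rintro x c c' ⟨k, j, rfl, hk⟩ hd
    obtain ⟨k', hk'⟩ := hfree c'
    have hA := fun i => eq_of_both_near hG hRow (c' i)
    obtain ⟨j', hj'⟩ := exists_unblocked hN (fun i k => ∃ z ∈ Row k, G.dist (c' i) z ≤ 3 * r)
      (fun i k => ∃ z ∈ Row k, G.dist (c' i) z ≤ 3 * r) hA hA
    obtain ⟨w, hw, hwc⟩ := (hwCol k j j').exists_walk_far hG hCr c' fun i z hz => by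
      have h1 := hk i z hz
      have h2 := hG.dist_triangle (u := c i) (v := c' i) (w := z)
      have h3 := hd i
      omega
    obtain ⟨w', hw', hwc'⟩ := (hwRow k k' j').exists_walk_far hG hCr c' fun i z hz => by
      by_contra! hcon
      exact (hj' i).1 ⟨z, hz, hcon⟩
    refine ⟨vert k' j', ⟨k', j', rfl, hk'⟩, w.append w', ?_, fun z hz => ?_⟩
    · rw [SimpleGraph.Walk.length_append, two_mul, Nat.add_mul]
      omega
    · rcases (SimpleGraph.Walk.mem_support_append_iff _ _).1 hz with hz | hz
      exacts [hwc z hz, hwc' z hz]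

/-- The cops lose if at every large scale there is a finite graph of large degree such that
the edges at each vertex diverge at a linear rate and the neighbours of each vertex are far from
each other. -/
theorem not_strongCopWin_of_stars (hG : G.Connected) (n N : ℕ) (hN : 2 * n < N) (K C D r₀ : ℕ)
    {ι : Type*} [Finite ι] [Nonempty ι] (nbr : ι → Fin N → ι)
    (h : ∀ r, r₀ ≤ r → ∃ (vert : ι → V) (E : ι → Fin N → Set V),
      (∀ u j j', j ≠ j' → 2 * ((4 + 6 * D) * r) < G.dist (vert (nbr u j)) (vert (nbr u j'))) ∧
      (∀ u j j', j ≠ j' → ∀ z ∈ E u j, ∀ z' ∈ E u j', G.dist z z' ≤ 6 * r →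
        G.dist (vert u) z ≤ D * (6 * r)) ∧
      (∀ u j, WalkNear G C (E u j) (K * r) (vert u) (vert (nbr u j)))) :
    ¬ StrongCopWin G n := by
  obtain ⟨v⟩ := hG.nonempty
  refine not_strongCopWin_of_safe hG n v K (max r₀ C) fun r hr => ?_
  obtain ⟨vert, E, hfar, hE, hw⟩ := h r (le_of_max_le_left hr)
  have hCr : C ≤ r := le_of_max_le_right hr
  have hnbr : ∀ (u : ι) (c : V) (j j' : Fin N),
      G.dist c (vert (nbr u j)) ≤ (4 + 6 * D) * r →
      G.dist c (vert (nbr u j')) ≤ (4 + 6 * D) * r → j = j' := fun u c j j' h1 h2 =>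
    eq_of_both_near hG (P := fun j => {vert (nbr u j)})
      (by simpa using hfar u) c j j' (by simpa using h1) (by simpa using h2)
  obtain ⟨R, hR⟩ := (Set.finite_range fun u : ι => G.dist v (vert u)).bddAbove
  refine ⟨R, fun x c => ∃ u, x = vert u ∧ ∀ i, (4 + 6 * D) * r < G.dist (c i) (vert u),
    ?_, ?_, ?_⟩
  · rintro x c ⟨u, rfl, -⟩
    exact hR ⟨u, rfl⟩
  · intro c
    obtain ⟨u⟩ := ‹Nonempty ι›
    have hA := fun i => hnbr u (c i)
    obtain ⟨j, hj⟩ := exists_unblocked hN _ _ hA hA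
    exact ⟨_, nbr u j, rfl, fun i => not_le.1 (hj i).1⟩
  · rintro x c c' ⟨u, rfl, hu⟩ hd
    -- A cop within `3 * r` of two edges at `u` sees points of them at distance at most `6 * r`, so
    -- it is within `(3 + 6 * D) * r` of `vert u`; but the clearance `(4 + 6 * D) * r` has shrunk by
    -- at most `r`.
    have hA : ∀ i j j', (∃ z ∈ E u j, G.dist (c' i) z ≤ 3 * r) →
        (∃ z ∈ E u j', G.dist (c' i) z ≤ 3 * r) → j = j' := by
      rintro i j j' ⟨z, hz, hcz⟩ ⟨z', hz', hcz'⟩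
      by_contra hne
      have h1 := hG.dist_triangle (u := z) (v := c' i) (w := z')
      rw [SimpleGraph.dist_comm (u := z) (v := c' i)] at h1
      have h2 := hE u j j' hne z hz z' hz' (by omega)
      rw [SimpleGraph.dist_comm] at h2
      have h3 := hG.dist_triangle (u := c' i) (v := z) (w := vert u)
      have h4 := hG.dist_triangle (u := c i) (v := c' i) (w := vert u)
      have h5 := hu i
      have h6 := hd i
      have h7 : (4 + 6 * D) * r = 4 * r + D * (6 * r) := by ring
      omega
    -- Each cop spoils at most one edge, by being near it, and at most one neighbour, as an unsafe
    -- endpoint.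
    obtain ⟨j, hj⟩ := exists_unblocked hN _ _ hA fun i => hnbr u (c' i)
    refine ⟨_, ⟨nbr u j, rfl, fun i => not_le.1 (hj i).2⟩, ?_⟩
    refine (hw u j).exists_walk_far hG hCr c' fun i z hz => ?_
    by_contra! hcon
    exact (hj i).1 ⟨z, hz, hcon⟩

end CopGame

/-! ### Distances in Cayley graphs. -/

section Cayley

variable {Γ : Type*} [Group Γ] (S : Set Γ)

lemma mulCayley_connected (hS : Subgroup.closure S = ⊤) :
    (SimpleGraph.mulCayley S).Connected := by
  have hr : ∀ g : Γ, ∀ x, (SimpleGraph.mulCayley S).Reachable x (x * g) := by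
    intro g
    have hg : g ∈ Subgroup.closure S := hS ▸ Subgroup.mem_top g
    induction hg using Subgroup.closure_induction with
    | mem s hs =>
      intro x
      by_cases h : x = x * s
      · rw [← h]
      · exact SimpleGraph.Adj.reachable
          ((SimpleGraph.mulCayley_adj' S _ _).2 ⟨h, s, hs, Or.inl rfl⟩)
    | one => intro x; rw [mul_one]
    | mul g h _ _ ihg ihh =>
      intro x
      rw [← mul_assoc]
      exact (ihg x).trans (ihh _)
    | inv g _ ih =>
      intro x
      simpa using (ih (x * g⁻¹)).symm
  have : Nonempty Γ := ⟨1⟩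
  refine SimpleGraph.Connected.mk fun x y => ?_
  simpa using hr (x⁻¹ * y) x

variable {S}

lemma dist_mul_left_le (hG : (SimpleGraph.mulCayley S).Connected) (g x y : Γ) :
    (SimpleGraph.mulCayley S).dist (g * x) (g * y) ≤ (SimpleGraph.mulCayley S).dist x y := by
  obtain ⟨w, hw⟩ := hG.exists_walk_length_eq_dist x y
  let f : SimpleGraph.mulCayley S →g SimpleGraph.mulCayley S :=
    ⟨fun x => g * x, fun h => SimpleGraph.mulCayley_adj_mul_iff_right.2 h⟩
  have := SimpleGraph.dist_le (w.map f)
  rw [SimpleGraph.Walk.length_map, hw] at this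
  exact this

lemma dist_mul_right_le (hG : (SimpleGraph.mulCayley S).Connected) (x g : Γ) :
    (SimpleGraph.mulCayley S).dist x (x * g) ≤ (SimpleGraph.mulCayley S).dist 1 g := by
  simpa using dist_mul_left_le hG x 1 g

lemma dist_mul_pow_le (hG : (SimpleGraph.mulCayley S).Connected) (x g : Γ) (k : ℕ) :
    (SimpleGraph.mulCayley S).dist x (x * g ^ k) ≤ k * (SimpleGraph.mulCayley S).dist 1 g := by
  induction k with
  | zero => simp
  | succ k ih =>
    have h1 := hG.dist_triangle (u := x) (v := x * g ^ k) (w := x * g ^ k * g)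
    have h2 := dist_mul_right_le hG (x * g ^ k) g
    rw [pow_succ, ← mul_assoc, Nat.add_mul]
    omega

end Cayley

/-! ### The affine action of `BS(1, m)` and lower bounds on word length. -/

namespace SolvableBS

variable (m : ℕ)

/-- The generator `a` of `BS(1, m)`. -/
def a : SolvableBS m := PresentedGroup.of 0

/-- The generator `t` of `BS(1, m)`. -/
def t : SolvableBS m := PresentedGroup.of 1

lemma t_mul_a : t m * a m = a m ^ m * t m := by
  have h : PresentedGroup.mk {solvableBSRel m} (solvableBSRel m) = 1 :=
    PresentedGroup.one_of_mem (Set.mem_singleton _)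
  simp only [solvableBSRel] at h
  exact mul_inv_eq_iff_eq_mul.1 (mul_inv_eq_one.1 h)

/-- At height `k`, a step of bounded length changes the `a`-exponent by a multiple of `m ^ k`; this
brings far apart segments together at a top vertex. -/
lemma t_pow_mul_a_pow (k i : ℕ) : t m ^ k * a m ^ i = a m ^ (i * m ^ k) * t m ^ k := by
  have h1 : ∀ i, t m * a m ^ i = a m ^ (i * m) * t m := by
    intro i
    induction i with
    | zero => simp
    | succ i ih =>
      rw [pow_succ, ← mul_assoc, ih, mul_assoc, t_mul_a, ← mul_assoc, ← pow_add, Nat.add_mul,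
        one_mul]
  induction k generalizing i with
  | zero => simp
  | succ k ih =>
    rw [pow_succ, mul_assoc, h1, ← mul_assoc, ih, mul_assoc, mul_assoc, pow_succ' m k]

/-- The height homomorphism, with `a ↦ 0` and `t ↦ 1`. -/
def height : SolvableBS m →* Multiplicative ℤ :=
  PresentedGroup.toGroup (f := ![1, Multiplicative.ofAdd 1]) (by
    rintro r rfl
    simp [solvableBSRel])

@[simp] lemma height_a : height m (a m) = 1 := by simp [height, a]

@[simp] lemma height_t : height m (t m) = Multiplicative.ofAdd 1 := by simp [height, t]

variable {m} (hm : 1 ≤ m)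

/-- The action of `BS(1, m)` on the line, with `a` acting by `x ↦ x + 1` and `t` by
`x ↦ m * x`. -/
noncomputable def act : SolvableBS m →* Equiv.Perm ℚ :=
  PresentedGroup.toGroup
    (f := ![Equiv.addRight 1, Equiv.mulRight₀ (m : ℚ) (by positivity)]) (by
    rintro r rfl
    have hm' : (m : ℚ) ≠ 0 := by positivity
    simp only [solvableBSRel, map_mul, map_inv, map_pow, FreeGroup.lift_apply_of,
      mul_inv_eq_iff_eq_mul]
    ext x
    simp [add_mul])

/-- The translation part of an element of `BS(1, m)`. -/
noncomputable def trans (g : SolvableBS m) : ℚ := act hm g 0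

@[simp] lemma act_a (x : ℚ) : act hm (a m) x = x + 1 := by simp [act, a]

@[simp] lemma act_t (x : ℚ) : act hm (t m) x = x * m := by simp [act, t]

lemma induction_gen {p : SolvableBS m → Prop} (ha : p (a m)) (ht : p (t m)) (h1 : p 1)
    (hmul : ∀ g h, p g → p h → p (g * h)) (hinv : ∀ g, p g → p g⁻¹) (g : SolvableBS m) : p g := by
  have hg : g ∈ Subgroup.closure
      (Set.range (PresentedGroup.of : Fin 2 → SolvableBS m)) := by
    rw [PresentedGroup.closure_range_of]; exact Subgroup.mem_top g
  induction hg using Subgroup.closure_induction with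
  | mem s hs =>
    obtain ⟨i, rfl⟩ := hs
    fin_cases i
    exacts [ha, ht]
  | one => exact h1
  | mul g h _ _ ihg ihh => exact hmul g h ihg ihh
  | inv g _ ih => exact hinv g ih

lemma act_apply (g : SolvableBS m) (x : ℚ) :
    act hm g x = (m : ℚ) ^ (height m g).toAdd * x + trans hm g := by
  have hm' : (m : ℚ) ≠ 0 := by positivity
  -- Differences eliminate the translation part, which makes the claim stable under products and
  -- inverses.
  have key : ∀ g : SolvableBS m, ∀ x y : ℚ,
      act hm g x - act hm g y = (m : ℚ) ^ (height m g).toAdd * (x - y) := by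
    intro g
    refine induction_gen (p := fun g => ∀ x y : ℚ,
      act hm g x - act hm g y = (m : ℚ) ^ (height m g).toAdd * (x - y)) ?_ ?_ ?_ ?_ ?_ g
    · intro x y; simp
    · intro x y; simp; ring
    · intro x y; simp
    · intro g h hg hh x y
      rw [map_mul, map_mul, Equiv.Perm.mul_apply, Equiv.Perm.mul_apply, hg, hh, toAdd_mul,
        zpow_add₀ hm', mul_assoc]
    · intro g hg x y
      have := hg (act hm g⁻¹ x) (act hm g⁻¹ y)
      rw [← Equiv.Perm.mul_apply, ← Equiv.Perm.mul_apply, ← map_mul, mul_inv_cancel, map_one,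
        Equiv.Perm.one_apply, Equiv.Perm.one_apply] at this
      rw [this, map_inv (height m), toAdd_inv, ← mul_assoc, ← zpow_add₀ hm', neg_add_cancel, zpow_zero,
        one_mul]
  have := key g x 0
  rw [sub_zero] at this
  rw [← this, trans, sub_add_cancel]

lemma trans_mul (g h : SolvableBS m) :
    trans hm (g * h) = (m : ℚ) ^ (height m g).toAdd * trans hm h + trans hm g := by
  rw [← act_apply, trans, trans, map_mul, Equiv.Perm.mul_apply]

@[simp] lemma trans_one : trans hm 1 = 0 := by simp [trans]

lemma trans_a_pow_mul_t_pow (b k : ℕ) : trans hm (a m ^ b * t m ^ k) = b := by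
  have h1 : trans hm (t m ^ k) = 0 := by
    induction k with
    | zero => simp
    | succ k ih => rw [pow_succ, trans_mul, ih]; simp [trans]
  have h2 : ∀ b : ℕ, trans hm (a m ^ b) = b := by
    intro b
    induction b with
    | zero => simp
    | succ k ih =>
      rw [pow_succ, trans_mul, ih]
      simp [trans, add_comm]
  rw [trans_mul, h1, h2]
  simp

lemma height_a_pow_mul_t_pow (b k : ℕ) : (height m (a m ^ b * t m ^ k)).toAdd = k := by
  simp

/-- An upper bound for the size of an element of `BS(1, m)`, in terms of its height and its
translation part. -/
def Small (D : ℕ) (g : SolvableBS m) : Prop :=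
  |(height m g).toAdd| ≤ D ∧ (∃ z : ℤ, (m : ℚ) ^ D * trans hm g = z) ∧
    |trans hm g| ≤ D * (m : ℚ) ^ D

namespace Small

variable {hm} {D E : ℕ} {g h : SolvableBS m}

lemma one : Small hm 0 (1 : SolvableBS m) := by
  refine ⟨by simp, ⟨0, by simp⟩, by simp⟩

/-- The factor `m ^ height g` costs at most `m ^ D` in denominator and in size. The bound `D * m ^
D` is shaped so that the parameters simply add, which makes smallness linear in word length. -/
lemma mul (hg : Small hm D g) (hh : Small hm E h) : Small hm (D + E) (g * h) := by
  obtain ⟨hg1, ⟨z, hz⟩, hg3⟩ := hg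
  obtain ⟨hh1, ⟨y, hy⟩, hh3⟩ := hh
  have hm1 : (1 : ℚ) ≤ m := by exact_mod_cast hm
  have hm' : (m : ℚ) ≠ 0 := by positivity
  have hle := abs_le.1 hg1
  refine ⟨?_, ?_, ?_⟩
  · rw [map_mul, toAdd_mul, Nat.cast_add]
    exact (abs_add_le _ _).trans (add_le_add hg1 hh1)
  · obtain ⟨e, he⟩ := Int.eq_ofNat_of_zero_le
      (show 0 ≤ (D : ℤ) + (height m g).toAdd by omega)
    refine ⟨(m : ℤ) ^ e * y + (m : ℤ) ^ E * z, ?_⟩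
    have h1 : (m : ℚ) ^ D * (m : ℚ) ^ (height m g).toAdd = (m : ℚ) ^ e := by
      rw [← zpow_natCast, ← zpow_natCast, ← zpow_add₀ hm', he]
    push_cast
    rw [trans_mul, ← hy, ← hz, ← h1, pow_add]
    ring
  · rw [trans_mul]
    refine (abs_add_le _ _).trans ?_
    rw [abs_mul, abs_of_pos (show 0 < (m : ℚ) ^ (height m g).toAdd by positivity)]
    have h1 : (m : ℚ) ^ (height m g).toAdd ≤ (m : ℚ) ^ D := by
      rw [← zpow_natCast]
      exact zpow_le_zpow_right₀ hm1 hle.2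
    calc (m : ℚ) ^ (height m g).toAdd * |trans hm h| + |trans hm g|
        ≤ (m : ℚ) ^ D * (E * (m : ℚ) ^ E) + D * (m : ℚ) ^ D * 1 := by
          rw [mul_one]; gcongr
      _ ≤ (m : ℚ) ^ D * (E * (m : ℚ) ^ E) + D * (m : ℚ) ^ D * (m : ℚ) ^ E := by
          gcongr; exact one_le_pow₀ hm1
      _ = _ := by push_cast; rw [pow_add]; ring

lemma mono (hDE : D ≤ E) (hg : Small hm D g) : Small hm E g := by
  obtain ⟨hg1, ⟨z, hz⟩, hg3⟩ := hg
  have hm1 : (1 : ℚ) ≤ m := by exact_mod_cast hm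
  refine ⟨hg1.trans (by exact_mod_cast hDE), ⟨(m : ℤ) ^ (E - D) * z, ?_⟩, hg3.trans ?_⟩
  · push_cast
    rw [← hz, ← mul_assoc, ← pow_add, Nat.sub_add_cancel hDE]
  · gcongr

/-- The translation part is rescaled by `m ^ (-height g)`, which costs a second `m ^ D`. In a walk
this loss is incurred only on single generators. -/
lemma inv (hg : Small hm D g) : Small hm (2 * D) g⁻¹ := by
  obtain ⟨hg1, ⟨z, hz⟩, hg3⟩ := hg
  have hm1 : (1 : ℚ) ≤ m := by exact_mod_cast hm
  have hm' : (m : ℚ) ≠ 0 := by positivity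
  have hle := abs_le.1 hg1
  have ht : trans hm g⁻¹ = - ((m : ℚ) ^ (-(height m g).toAdd) * trans hm g) := by
    have h := trans_mul hm g⁻¹ g
    rw [inv_mul_cancel, trans_one, map_inv, toAdd_inv] at h
    linarith
  refine ⟨?_, ?_, ?_⟩
  · rw [map_inv, toAdd_inv, abs_neg]
    push_cast
    omega
  · obtain ⟨e, he⟩ := Int.eq_ofNat_of_zero_le
      (show 0 ≤ (D : ℤ) + -(height m g).toAdd by omega)
    refine ⟨-((m : ℤ) ^ e * z), ?_⟩
    have h1 : (m : ℚ) ^ D * (m : ℚ) ^ (-(height m g).toAdd) = (m : ℚ) ^ e := by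
      rw [← zpow_natCast, ← zpow_natCast, ← zpow_add₀ hm', he]
    push_cast
    rw [ht, ← hz, ← h1, two_mul, pow_add]
    ring
  · rw [ht, abs_neg, abs_mul, abs_of_pos (show 0 < (m : ℚ) ^ (-(height m g).toAdd) by positivity)]
    have h1 : (m : ℚ) ^ (-(height m g).toAdd) ≤ (m : ℚ) ^ D := by
      rw [← zpow_natCast]
      exact zpow_le_zpow_right₀ hm1 (by omega)
    calc (m : ℚ) ^ (-(height m g).toAdd) * |trans hm g|
        ≤ (m : ℚ) ^ D * (D * (m : ℚ) ^ D) := by gcongr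
      _ = D * (m : ℚ) ^ (2 * D) := by rw [two_mul, pow_add]; ring
      _ ≤ ((2 * D : ℕ) : ℚ) * (m : ℚ) ^ (2 * D) := by
          gcongr
          omega

end Small

lemma exists_small (g : SolvableBS m) : ∃ D, Small hm D g := by
  refine induction_gen (p := fun g => ∃ D, Small hm D g) ?_ ?_ ⟨0, Small.one⟩ ?_ ?_ g
  · refine ⟨1, by simp, ⟨m, by simp [trans]⟩, ?_⟩
    simp only [trans, act_a]
    simpa using hm
  · exact ⟨1, by simp, ⟨0, by simp [trans]⟩, by simp [trans]⟩
  · rintro g h ⟨D, hD⟩ ⟨E, hE⟩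
    exact ⟨_, hD.mul hE⟩
  · rintro g ⟨D, hD⟩
    exact ⟨_, hD.inv⟩

/-- Elements at bounded distance in a Cayley graph differ by a small element. -/
lemma exists_small_of_dist_le {S : Set (SolvableBS m)} (hfin : S.Finite)
    (hG : (SimpleGraph.mulCayley S).Connected) :
    ∃ C, 1 ≤ C ∧ ∀ x y D, (SimpleGraph.mulCayley S).dist x y ≤ D →
      Small hm (C * D) (x⁻¹ * y) := by
  choose B hB using exists_small hm
  obtain ⟨C, hC⟩ := (hfin.image B).bddAbove
  -- `2 * C` covers inverses of generators; `+ 1` makes the constant positive.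
  have hstep : ∀ x y, (SimpleGraph.mulCayley S).Adj x y →
      Small hm (2 * C + 1) (x⁻¹ * y) := by
    intro x y hxy
    have hs : ∀ s ∈ S, Small hm C s := fun s hs =>
      (hB s).mono (hC (Set.mem_image_of_mem B hs))
    obtain ⟨-, h | h⟩ := (SimpleGraph.mulCayley_adj S x y).1 hxy
    · exact (hs _ h).mono (by omega)
    · have := (hs _ h).inv
      rw [mul_inv_rev, inv_inv] at this
      exact this.mono (by omega)
  have hwalk : ∀ x y (w : (SimpleGraph.mulCayley S).Walk x y),
      Small hm ((2 * C + 1) * w.length) (x⁻¹ * y) := by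
    intro x y w
    induction w with
    | nil => simpa using Small.one
    | @cons u v w h p ih =>
      have := (hstep _ _ h).mul ih
      rw [mul_assoc, mul_inv_cancel_left] at this
      refine this.mono (le_of_eq ?_)
      rw [SimpleGraph.Walk.length_cons]
      ring
  refine ⟨2 * C + 1, by omega, fun x y D hD => ?_⟩
  obtain ⟨w, hw⟩ := hG.exists_walk_length_eq_dist x y
  exact (hwalk x y w).mono (Nat.mul_le_mul_left _ (hw.trans_le hD))

end SolvableBS

/-! ### The grid in `ℤ²` and the bipartite graphs for `m ≥ 2`. -/

namespace SolvableBS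

open CopGame

variable {m : ℕ} {hm : 1 ≤ m}

/-- Here `b' - b` is `m ^ h` times the translation part of the quotient, so the bound on its
denominator becomes a divisibility and the bound on its size an estimate. -/
lemma Small.of_pow {D b h b' h' : ℕ}
    (hs : Small hm D ((a m ^ b * t m ^ h)⁻¹ * (a m ^ b' * t m ^ h'))) :
    |(h' : ℤ) - h| ≤ D ∧ (m : ℤ) ^ h ∣ (m : ℤ) ^ D * ((b' : ℤ) - b) ∧
      |(b' : ℤ) - b| ≤ D * (m : ℤ) ^ (D + h) := by
  obtain ⟨h1, ⟨z, hz⟩, h3⟩ := hs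
  have hmul := trans_mul hm (a m ^ b * t m ^ h) ((a m ^ b * t m ^ h)⁻¹ * (a m ^ b' * t m ^ h'))
  rw [mul_inv_cancel_left, trans_a_pow_mul_t_pow, trans_a_pow_mul_t_pow, height_a_pow_mul_t_pow,
    zpow_natCast] at hmul
  set x := trans hm ((a m ^ b * t m ^ h)⁻¹ * (a m ^ b' * t m ^ h'))
  have hx : (b' : ℚ) - b = (m : ℚ) ^ h * x := by linarith
  refine ⟨?_, ⟨z, ?_⟩, ?_⟩
  · rw [map_mul, map_inv, toAdd_mul, toAdd_inv, height_a_pow_mul_t_pow,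
      height_a_pow_mul_t_pow] at h1
    rwa [sub_eq_neg_add]
  · have : (m : ℚ) ^ D * ((b' : ℚ) - b) = (m : ℚ) ^ h * z := by rw [hx, ← hz]; ring
    exact_mod_cast this
  · have : |(b' : ℚ) - b| ≤ D * (m : ℚ) ^ (D + h) := by
      rw [hx, abs_mul, abs_of_nonneg (by positivity), pow_add]
      calc (m : ℚ) ^ h * |x| ≤ (m : ℚ) ^ h * (D * (m : ℚ) ^ D) := by gcongr
        _ = _ := by ring
    exact_mod_cast this

variable {S : Set (SolvableBS m)}

lemma dist_pow_le (hG : (SimpleGraph.mulCayley S).Connected) {h h' : ℕ} (hh : h ≤ h') (b : ℕ) :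
    (SimpleGraph.mulCayley S).dist (a m ^ b * t m ^ h) (a m ^ b * t m ^ h') ≤
      (h' - h) * (SimpleGraph.mulCayley S).dist 1 (t m) := by
  have := dist_mul_pow_le hG (a m ^ b * t m ^ h) (t m) (h' - h)
  rwa [mul_assoc, ← pow_add, Nat.add_sub_cancel' hh] at this

/-- The case of `ℤ²`. -/
theorem not_strongCopWin_one {S : Set (SolvableBS 1)} (hfin : S.Finite)
    (hG : (SimpleGraph.mulCayley S).Connected) (n : ℕ) :
    ¬ StrongCopWin (SimpleGraph.mulCayley S) n := by
  obtain ⟨C, hC, hsmall⟩ := exists_small_of_dist_le (hm := le_refl 1) hfin hG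
  set G := SimpleGraph.mulCayley S
  set B := max (G.dist 1 (a 1)) (G.dist 1 (t 1))
  set N := 2 * n + 1
  have hlow : ∀ b h b' h' D : ℕ, G.dist (a 1 ^ b * t 1 ^ h) (a 1 ^ b' * t 1 ^ h') ≤ D →
      |(h' : ℤ) - h| ≤ (C * D : ℕ) ∧ |(b' : ℤ) - b| ≤ (C * D : ℕ) := by
    intro b h b' h' D hD
    obtain ⟨h1, -, h3⟩ := (hsmall _ _ D hD).of_pow
    exact ⟨h1, by simpa using h3⟩
  have hgap : ∀ (M D : ℕ) (i i' : Fin N), i ≠ i' → C * D < M →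
      ¬ |((i' * M : ℕ) : ℤ) - (i * M : ℕ)| ≤ (C * D : ℕ) := by
    intro M D i i' hne hM hle
    have h1 : (1 : ℤ) ≤ |(i' : ℤ) - i| := Int.one_le_abs fun h => hne (Fin.ext (by omega))
    have h2 : |((i' * M : ℕ) : ℤ) - (i * M : ℕ)| = |(i' : ℤ) - i| * M := by
      push_cast
      rw [← sub_mul, abs_mul, Nat.abs_cast]
    have h3 : ((C * D : ℕ) : ℤ) < M := by exact_mod_cast hM
    nlinarith
  refine not_strongCopWin_of_grid hG n N (by omega) (N * (8 * C + 1) * B) B 1 fun r hr => ?_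
  -- The spacing must exceed `C * (8 * r)`, the largest coordinate difference at distance `8 * r`.
  obtain ⟨M, hMdef⟩ : ∃ M, M = (8 * C + 1) * r := ⟨_, rfl⟩
  have hM : C * (2 * (4 * r)) < M := by
    have : M = C * (2 * (4 * r)) + r := by rw [hMdef]; ring
    omega
  have hM' : C * (2 * (3 * r)) < M := lt_of_le_of_lt (by gcongr; omega) hM
  have hlen : ∀ j j' : Fin N, (j' * M - j * M) * B ≤ N * (8 * C + 1) * B * r := by
    intro j j'
    calc (j' * M - j * M) * B ≤ N * M * B := by
          gcongr
          exact (Nat.sub_le _ _).trans (Nat.mul_le_mul_right _ j'.2.le)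
      _ = _ := by rw [hMdef]; ring
  have hcomm : ∀ x y : ℕ, a 1 ^ x * t 1 ^ y * a 1 = a 1 ^ (x + 1) * t 1 ^ y := by
    intro x y
    have := t_pow_mul_a_pow 1 y 1
    rw [one_pow, one_mul, pow_one] at this
    rw [mul_assoc, this, pow_succ, mul_assoc]
  refine ⟨fun i j => a 1 ^ (i * M : ℕ) * t 1 ^ (j * M : ℕ),
    fun i => Set.range fun y : ℕ => a 1 ^ (i * M : ℕ) * t 1 ^ y,
    fun j => Set.range fun x : ℕ => a 1 ^ x * t 1 ^ (j * M : ℕ), ?_, ?_, ?_, ?_⟩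
  · rintro i i' hne _ ⟨y, rfl⟩ _ ⟨y', rfl⟩
    by_contra! hcon
    exact hgap M _ i i' hne hM (hlow _ _ _ _ _ hcon).2
  · rintro j j' hne _ ⟨x, rfl⟩ _ ⟨x', rfl⟩
    by_contra! hcon
    exact hgap M _ j j' hne hM' (hlow _ _ _ _ _ hcon).1
  · have key : ∀ i j j' : Fin N, j ≤ j' → WalkNear G B
        (Set.range fun y : ℕ => a 1 ^ (i * M : ℕ) * t 1 ^ y) (N * (8 * C + 1) * B * r)
        (a 1 ^ (i * M : ℕ) * t 1 ^ (j * M : ℕ)) (a 1 ^ (i * M : ℕ) * t 1 ^ (j' * M : ℕ)) := by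
      intro i j j' hj
      have hle : j * M ≤ j' * M := Nat.mul_le_mul_right _ hj
      have := WalkNear.chain (C := B) (P := Set.range fun y : ℕ => a 1 ^ (i * M : ℕ) * t 1 ^ y)
        hG (fun k => a 1 ^ (i * M : ℕ) * t 1 ^ (j * M + k : ℕ)) (j' * M - j * M)
        (fun k _ => ⟨_, rfl⟩) (fun k _ => by
          rw [← Nat.add_assoc, pow_succ, ← mul_assoc]
          exact (dist_mul_right_le hG _ _).trans (le_max_right _ _))
      rw [Nat.add_zero, Nat.add_sub_cancel' hle] at this
      exact this.mono (hlen j j')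
    intro i j j'
    rcases le_total j j' with h | h
    exacts [key i j j' h, (key i j' j h).symm]
  · have key : ∀ i i' j : Fin N, i ≤ i' → WalkNear G B
        (Set.range fun x : ℕ => a 1 ^ x * t 1 ^ (j * M : ℕ)) (N * (8 * C + 1) * B * r)
        (a 1 ^ (i * M : ℕ) * t 1 ^ (j * M : ℕ)) (a 1 ^ (i' * M : ℕ) * t 1 ^ (j * M : ℕ)) := by
      intro i i' j hi
      have hle : i * M ≤ i' * M := Nat.mul_le_mul_right _ hi
      have := WalkNear.chain (C := B) (P := Set.range fun x : ℕ => a 1 ^ x * t 1 ^ (j * M : ℕ))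
        hG (fun k => a 1 ^ (i * M + k : ℕ) * t 1 ^ (j * M : ℕ)) (i' * M - i * M)
        (fun k _ => ⟨_, rfl⟩) (fun k _ => by
          rw [← Nat.add_assoc, ← hcomm]
          exact (dist_mul_right_le hG _ _).trans (le_max_left _ _))
      rw [Nat.add_zero, Nat.add_sub_cancel' hle] at this
      exact this.mono (hlen i i')
    intro i i' j
    rcases le_total i i' with h | h
    exacts [key i i' j h, (key i' i j h).symm]

/-- `m ^ h` divides the nonzero number `m ^ D * (j' - j)`, where `|j' - j| < m ^ N`. Thus segments
with a common bottom are close only near it. -/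
lemma Small.height_lt {N D h h' b j j' : ℕ} (hm2 : 2 ≤ m) (hj : j < N) (hj' : j' < N)
    (hne : j ≠ j')
    (hs : Small hm D ((a m ^ (b + j) * t m ^ h)⁻¹ * (a m ^ (b + j') * t m ^ h'))) :
    h < D + N := by
  obtain ⟨-, hdvd, -⟩ := hs.of_pow
  have h1 : ((b + j' : ℕ) : ℤ) - (b + j : ℕ) = j' - j := by push_cast; ring
  rw [h1] at hdvd
  have h2 : |(j' : ℤ) - j| < (m : ℤ) ^ N := by
    have h3 : (N : ℤ) < (m : ℤ) ^ N := by exact_mod_cast Nat.lt_pow_self (by omega)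
    exact lt_of_le_of_lt (abs_le.2 ⟨by omega, by omega⟩) h3
  have hpos : (0 : ℤ) < (m : ℤ) ^ D := by positivity
  have hne' : (m : ℤ) ^ D * ((j' : ℤ) - j) ≠ 0 :=
    mul_ne_zero hpos.ne' (by omega)
  have h4 := Int.le_of_dvd (abs_pos.2 hne') ((dvd_abs _ _).2 hdvd)
  rw [abs_mul, abs_of_pos hpos] at h4
  have h5 : (m : ℤ) ^ h < (m : ℤ) ^ (D + N) := by
    rw [pow_add]
    exact h4.trans_lt (mul_lt_mul_of_pos_left h2 hpos)
  exact (pow_lt_pow_iff_right₀ (by exact_mod_cast hm2)).1 h5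

/-- The exponents differ by at least `m ^ L`, but smallness allows only `D * m ^ (D + h) ≤ m ^ (2 *
D + h)`. Thus segments with a common top, at height `L`, are close only near it. -/
lemma Small.le_height {L D h h' b i i' : ℕ} (hm2 : 2 ≤ m) (hne : i ≠ i')
    (hs : Small hm D ((a m ^ (i * m ^ L + b) * t m ^ h)⁻¹ *
      (a m ^ (i' * m ^ L + b) * t m ^ h'))) :
    L ≤ 2 * D + h := by
  obtain ⟨-, -, hle⟩ := hs.of_pow
  have h1 : ((i' * m ^ L + b : ℕ) : ℤ) - (i * m ^ L + b : ℕ) = (i' - i) * (m : ℤ) ^ L := by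
    push_cast; ring
  have hpos : (0 : ℤ) < (m : ℤ) ^ L := by positivity
  rw [h1, abs_mul, abs_of_pos hpos] at hle
  have h2 : (1 : ℤ) ≤ |(i' : ℤ) - i| := Int.one_le_abs (by omega)
  have h3 : (D : ℤ) ≤ (m : ℤ) ^ D := by exact_mod_cast (Nat.lt_pow_self (by omega)).le
  have h4 : (m : ℤ) ^ L ≤ (m : ℤ) ^ (2 * D + h) := by
    calc (m : ℤ) ^ L ≤ |(i' : ℤ) - i| * (m : ℤ) ^ L := le_mul_of_one_le_left hpos.le h2
      _ ≤ D * (m : ℤ) ^ (D + h) := hle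
      _ ≤ (m : ℤ) ^ D * (m : ℤ) ^ (D + h) := by gcongr
      _ = _ := by ring
  exact (pow_le_pow_iff_right₀ (by exact_mod_cast hm2)).1 h4

/-- For `m ≥ 2`, the robber uses large complete bipartite graphs whose edges are vertical
segments. -/
theorem not_strongCopWin_of_two_le (hm2 : 2 ≤ m) (hfin : S.Finite)
    (hG : (SimpleGraph.mulCayley S).Connected) (n : ℕ) :
    ¬ StrongCopWin (SimpleGraph.mulCayley S) n := by
  have hm : 1 ≤ m := by omega
  obtain ⟨C, hC, hsmall⟩ := exists_small_of_dist_le (hm := hm) hfin hG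
  set G := SimpleGraph.mulCayley S
  set N := 2 * n + 1
  set B := max (N * G.dist 1 (a m)) (G.dist 1 (t m))
  -- Segments from a common vertex within `6 * r` of each other are so at vertical distance at most
  -- `2 * C * (6 * r)` from a top, or `C * (6 * r) + N` from a bottom; the `1` pays for the step
  -- from the vertex to its segment.
  set D := B * (1 + 2 * C + N) with hD
  -- Makes `L = M * r` exceed the thresholds of both divergence lemmas at distance `2 * ((4 + 6 * D)
  -- * r)`, so distinct tops, and distinct bottoms, are far apart.
  set M := 4 * C * (4 + 6 * D) + N + 1 with hM
  have : NeZero N := ⟨by omega⟩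
  refine not_strongCopWin_of_stars (ι := Fin N ⊕ Fin N) hG n N (by omega) ((M + 2) * B) B D 1
    (Sum.elim (fun _ i => .inr i) (fun _ j => .inl j)) fun r hr => ?_
  set L := M * r with hL
  let top (j : Fin N) : SolvableBS m := a m ^ (j : ℕ) * t m ^ L
  let bot (i : Fin N) : SolvableBS m := a m ^ (i * m ^ L : ℕ)
  let pt (i j : Fin N) (h : ℕ) : SolvableBS m := a m ^ (i * m ^ L + j : ℕ) * t m ^ h
  let seg (i j : Fin N) : Set (SolvableBS m) := {z | ∃ h ≤ L, z = pt i j h}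
  have hpow : ∀ (x : SolvableBS m) (i : Fin N), G.dist x (x * a m ^ (i : ℕ)) ≤ B := fun x i =>
    (dist_mul_pow_le hG x (a m) i).trans
      ((Nat.mul_le_mul_right _ i.2.le).trans (le_max_left _ _))
  have hht : G.dist 1 (t m) ≤ B := le_max_right _ _
  have htop : ∀ i j, G.dist (top j) (pt i j L) ≤ B := by
    intro i j
    have h1 : pt i j L = top j * a m ^ (i : ℕ) := by
      simp only [pt, top]
      rw [mul_assoc, t_pow_mul_a_pow, ← mul_assoc, ← pow_add, Nat.add_comm]
    rw [h1]
    exact hpow _ i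
  have hbot : ∀ i j, G.dist (bot i) (pt i j 0) ≤ B := by
    intro i j
    have h1 : pt i j 0 = bot i * a m ^ (j : ℕ) := by
      simp only [pt, bot]
      rw [pow_zero, mul_one, pow_add]
    rw [h1]
    exact hpow _ j
  have hseg : ∀ i j h h', h ≤ h' → G.dist (pt i j h) (pt i j h') ≤ (h' - h) * B :=
    fun i j h h' hh => (dist_pow_le hG hh _).trans (Nat.mul_le_mul_left _ hht)
  have hwalk : ∀ i j, WalkNear G B (seg i j) ((M + 2) * B * r) (top j) (bot i) := by
    intro i j
    have h1 : WalkNear G B (seg i j) B (top j) (pt i j L) :=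
      WalkNear.symm (WalkNear.of_dist_le hG ⟨L, le_rfl, rfl⟩ (by
        rw [SimpleGraph.dist_comm]; exact htop i j))
    have h2 : WalkNear G B (seg i j) (L * B) (pt i j 0) (pt i j L) :=
      WalkNear.chain hG (fun k => pt i j k) L (fun k hk => ⟨k, hk, rfl⟩) fun k _ => by
        simpa using hseg i j k (k + 1) (by omega)
    have h3 : WalkNear G B (seg i j) B (pt i j 0) (bot i) :=
      WalkNear.of_dist_le hG ⟨0, Nat.zero_le _, rfl⟩ (by
        rw [SimpleGraph.dist_comm]; exact hbot i j)
    refine ((h1.trans h2.symm).trans h3).mono ?_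
    calc B + L * B + B = M * B * r + 2 * B * 1 := by rw [hL]; ring
      _ ≤ M * B * r + 2 * B * r := by gcongr
      _ = (M + 2) * B * r := by ring
  have hLgt : 2 * (C * (2 * ((4 + 6 * D) * r))) + N < L := by
    have h1 : L = 2 * (C * (2 * ((4 + 6 * D) * r))) + N * r + r := by rw [hL, hM]; ring
    have h2 : N ≤ N * r := Nat.le_mul_of_pos_right _ hr
    omega
  have hBr : B ≤ B * (6 * r) := Nat.le_mul_of_pos_right _ (by omega)
  have hNr : N * B ≤ N * B * (6 * r) := Nat.le_mul_of_pos_right _ (by omega)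
  refine ⟨Sum.elim top bot, Sum.elim (fun j i => seg i j) (fun i j => seg i j), ?_, ?_, ?_⟩
  · rintro (u | u) j j' hne
    · by_contra! hcon
      have h1 := hsmall _ _ _ hcon
      have h2 := Small.le_height (b := 0) (h := 0) (h' := 0) (i := j) (i' := j') (L := L) hm2
        (fun h => hne (Fin.ext h)) (by simpa [bot] using h1)
      omega
    · by_contra! hcon
      have h1 := hsmall _ _ _ hcon
      have h2 := Small.height_lt (b := 0) (h := L) (h' := L) (j := j) (j' := j') hm2 j.2 j'.2
        (fun h => hne (Fin.ext h)) (by simpa [top] using h1)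
      omega
  · rintro (u | u) j j' hne z ⟨h, hh, rfl⟩ z' ⟨h', hh', rfl⟩ hd
    · have h2 := Small.le_height hm2 (fun h => hne (Fin.ext h)) (hsmall _ _ _ hd)
      have h3 := hG.dist_triangle (u := top u) (v := pt j u L) (w := pt j u h)
      have h4 := htop j u
      have h5 := hseg j u h L hh
      rw [SimpleGraph.dist_comm] at h5
      have h6 : (L - h) * B ≤ 2 * (C * (6 * r)) * B := Nat.mul_le_mul_right _ (by omega)
      have h7 : D * (6 * r) = B * (6 * r) + 2 * (C * (6 * r)) * B + N * B * (6 * r) := by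
        rw [hD]; ring
      change G.dist (top u) (pt j u h) ≤ _
      omega
    · have h2 := Small.height_lt hm2 j.2 j'.2 (fun h => hne (Fin.ext h)) (hsmall _ _ _ hd)
      have h3 := hG.dist_triangle (u := bot u) (v := pt u j 0) (w := pt u j h)
      have h4 := hbot u j
      have h5 := hseg u j 0 h (Nat.zero_le _)
      have h6 : (h - 0) * B ≤ (C * (6 * r) + N) * B := Nat.mul_le_mul_right _ (by omega)
      have h7 : D * (6 * r) = B * (6 * r) + 2 * (C * (6 * r) * B) + N * B * (6 * r) := by
        rw [hD]; ring
      rw [Nat.add_mul] at h6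
      change G.dist (bot u) (pt u j h) ≤ _
      omega
  · rintro (u | u) j
    exacts [hwalk j u, (hwalk u j).symm]

end SolvableBS

theorem theoremE (m : ℕ) (hm : 1 ≤ m) (S : Set (SolvableBS m)) (hfin : S.Finite)
    (hgen : Subgroup.closure S = ⊤) :
    CopGame.sCop (SimpleGraph.mulCayley S) = ⊤ ∧ CopGame.wCop (SimpleGraph.mulCayley S) = ⊤ := by
  have hG := mulCayley_connected S hgen
  refine CopGame.sCop_and_wCop_eq_top fun n => ?_
  rcases hm.eq_or_lt with rfl | hm2
  · exact SolvableBS.not_strongCopWin_one hfin hG n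
  · exact SolvableBS.not_strongCopWin_of_two_le hm2 hfin hG n
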